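/- A finite POMDP $(W,S,A,\alpha,\beta,R)$ consists of finite sets $W$ (world states), $S$ (sensor states), $A$ (actions), with $W$ and $A$ nonempty, of probability distributions $\alpha(\cdot\mid w,a)$ on $W$ and $\beta(\cdot\mid w)$ on $S$ for $w\in W$, $a\in A$, and of a reward $R\colon W\times A\to\mathbb R$. A stationary policy is a family $\pi=(\pi(\cdot\mid s))_{s\in S}$ of probability distributions on $A$; these form the policy polytope $\Delta_{S,A}$. Under $\pi$ and a start distribution $\mu$ on $W$, the trajectory $(w_0,a_0),(w_1,a_1),\dots$ satisfies $w_0\sim\mu$; in the world state $w$ the action $a$ is chosen with probability $\sum_s\pi(a\mid s)\beta(s\mid w)$, and then the next world state is drawn from $\alpha(\cdot\mid w,a)$. The average reward is $\lim_{T\to\infty}\mathbb E\big[\tfrac1T\sum_{t<T}R(w_t,a_t)\big]$ and, for $\gamma\in(0,1)$, the discounted reward is $\lim_{T\to\infty}\mathbb E\big[\sum_{t<T}\gamma^tR(w_t,a_t)\big]$. An optimal stationary policy maximizes the reward in question over $\Delta_{S,A}$ (for the average reward: for every start distribution $\mu$). Let $U=\{s\in S:\beta(s\mid w)>0\text{ for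 more than one }w\in W\}$. A policy is called $m$-stochastic if it lies in an $m$-dimensional face of the polytope $\Delta_{S,A}$. 1. If under every stationary policy of the POMDP there is exactly one stationary distribution on $W$, then there is an optimal stationary policy for the average reward that is $|U|(|A|-1)$-stochastic. 2. For every POMDP, every $\gamma\in(0,1)$ and every start distribution $\mu$, there is an optimal stationary policy for the discounted reward that is $|U|(|A|-1)$-stochastic. 3. The bound is sharp, in both settings. Let $W,S,A$ be finite sets and $V\subseteq S$ a nonempty subset with $|V|\,|A|<|W|$, where $A\ne\emptyset$. Then there are $\alpha,\beta,R$ with $U=V$ such that under every stationary policy there is exactly one stationary distribution on $W$, which is the limit of the law of $w_t$ as $t\to\infty$ for every start distribution, and such that no optimal stationary policy for the average reward lies in a face of $\Delta_{S,A}$ of dimension less than $|U|(|A|-1)$. Likewise, for every $\gamma\in(0,1)$ and every start distribution $\mu$ there are $\alpha,\beta,R$ with $U=V$ and the same property of stationary distributions, such that no optimal stationary policy for the discounted reward with $\gamma$ and $\mu$ lies in a face of dimension less than $|U|(|A|-1)$. -/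

import Mathlib

/-- A finite partially observable Markov decision process with world states `W`, sensor states `S`
and actions `A`: `α w a w'` is the probability of moving to `w'` when action `a` is taken in `w`,
`β w s` is the probability of sensing `s` in `w`, and `R w a` is the reward. -/
structure POMDP (W S A : Type*) [Fintype W] [Fintype S] where
  α : W → A → W → ℝ
  α_mem : ∀ w a, α w a ∈ stdSimplex ℝ W
  β : W → S → ℝ
  β_mem : ∀ w, β w ∈ stdSimplex ℝ S
  R : W → A → ℝ

/-- The polytope of stationary (memoryless, time independent) policies; `π s a` is the probability
of choosing the action `a` when `s` is sensed. -/
def policyPolytope (S A : Type*) [Fintype A] : Set (S → A → ℝ) :=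
  {π | ∀ s, π s ∈ stdSimplex ℝ A}

/-- `π` is `m`-stochastic: it lies in an `m`-dimensional face of the policy polytope. A nonempty
face of a polytope is the set of maximizers of a linear functional; its dimension is that of its
affine hull. -/
def IsStochastic {S A : Type*} [Fintype A] (m : ℕ) (π : S → A → ℝ) : Prop :=
  ∃ F : Set (S → A → ℝ), IsExposed ℝ (policyPolytope S A) F ∧ π ∈ F ∧
    Module.finrank ℝ (vectorSpan ℝ F) = m

namespace POMDP

open Filter Topology

variable {W S A : Type*} [Fintype W] [Fintype S] [Fintype A]

/-- The sensor states that arise with positive probability from more than one world state. -/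
def ambiguous (M : POMDP W S A) : Set S :=
  {s | 1 < {w | M.β w s ≠ 0}.ncard}

/-- The probability of the action `a` in the world state `w` under the policy `π`. -/
def actionProb (M : POMDP W S A) (π : S → A → ℝ) (w : W) (a : A) : ℝ :=
  ∑ s, π s a * M.β w s

/-- The world state transition matrix under the policy `π`. -/
def transition (M : POMDP W S A) (π : S → A → ℝ) : Matrix W W ℝ :=
  Matrix.of fun w w' => ∑ a, M.actionProb π w a * M.α w a w'

/-- `p` is a stationary world state distribution under the policy `π`. -/
def IsStationary (M : POMDP W S A) (π : S → A → ℝ) (p : W → ℝ) : Prop :=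
  p ∈ stdSimplex ℝ W ∧ Matrix.vecMul p (M.transition π) = p

/-- Every stationary policy has exactly one stationary world state distribution. -/
def UniqueStationary (M : POMDP W S A) : Prop :=
  ∀ π ∈ policyPolytope S A, ∃! p, M.IsStationary π p

/-- The stationary world state distributions are attained in the limit of infinite time,
irrespective of the start distribution. -/
def AttainsStationary [DecidableEq W] (M : POMDP W S A) : Prop :=
  ∀ π ∈ policyPolytope S A, ∀ p, M.IsStationary π p → ∀ μ ∈ stdSimplex ℝ W,
    Tendsto (fun t : ℕ => Matrix.vecMul μ (M.transition π ^ t)) atTop (𝓝 p)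

/-- The probability of the trajectory `h = (w₀, a₀), …, (wₙ, aₙ)` under the policy `π` and the start
distribution `μ`. -/
def trajProb (M : POMDP W S A) (π : S → A → ℝ) (μ : W → ℝ) {n : ℕ}
    (h : Fin (n + 1) → W × A) : ℝ :=
  μ (h 0).1 * (∏ t : Fin (n + 1), M.actionProb π (h t).1 (h t).2) *
    ∏ t : Fin n, M.α (h t.castSucc).1 (h t.castSucc).2 (h t.succ).1

/-- The expectation of a function of the first `n + 1` world states and actions. -/
def expect (M : POMDP W S A) (π : S → A → ℝ) (μ : W → ℝ) (n : ℕ)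
    (f : (Fin (n + 1) → W × A) → ℝ) : ℝ :=
  ∑ h, M.trajProb π μ h * f h

/-- `r` is the long term expected reward per time step (with `T = n + 1` time steps). -/
def IsAverageReward (M : POMDP W S A) (μ : W → ℝ) (π : S → A → ℝ) (r : ℝ) : Prop :=
  Tendsto (fun n : ℕ => M.expect π μ n fun h =>
    (1 / ((n : ℝ) + 1)) * ∑ t, M.R (h t).1 (h t).2) atTop (𝓝 r)

/-- `r` is the long term expected reward with discount factor `γ` (with `T = n + 1` time steps). -/
def IsDiscountedReward (M : POMDP W S A) (γ : ℝ) (μ : W → ℝ) (π : S → A → ℝ) (r : ℝ) : Prop :=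
  Tendsto (fun n : ℕ => M.expect π μ n fun h =>
    ∑ t : Fin (n + 1), γ ^ (t : ℕ) * M.R (h t).1 (h t).2) atTop (𝓝 r)

/-- `π` is an optimal stationary policy for the average reward: whatever the start distribution,
all stationary policies have an average reward, and that of `π` is the largest. -/
def IsOptimalAverage (M : POMDP W S A) (π : S → A → ℝ) : Prop :=
  π ∈ policyPolytope S A ∧ ∀ μ ∈ stdSimplex ℝ W, ∃ r, M.IsAverageReward μ π r ∧
    ∀ π' ∈ policyPolytope S A, ∃ r', M.IsAverageReward μ π' r' ∧ r' ≤ r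

/-- `π` is an optimal stationary policy for the discounted reward with discount factor `γ` and start
distribution `μ`. -/
def IsOptimalDiscounted (M : POMDP W S A) (γ : ℝ) (μ : W → ℝ) (π : S → A → ℝ) : Prop :=
  π ∈ policyPolytope S A ∧ ∃ r, M.IsDiscountedReward γ μ π r ∧
    ∀ π' ∈ policyPolytope S A, ∃ r', M.IsDiscountedReward γ μ π' r' ∧ r' ≤ r

end POMDP

/-! Discounting is a restart. Following the dynamics with probability γ and redrawing the world
state from μ otherwise gives a chain whose stationary distribution p is the normalized discounted
occupation measure, and the discounted reward is p·r/(1-γ) (`isDiscountedReward`). Restarted chains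
always have a unique, attracting stationary distribution, so both settings amount to maximizing the
stationary reward p·r_π over policies.

Existence is one step of policy improvement (`exists_maximal_isStochastic`). A maximal pair (π, p)
exists by compactness; let h solve the Poisson equation r_π + P_π h = p·r_π + h, and let q(w,a) =
R(w,a) + α(·|w,a)·h. A sensor state outside U comes from at most one world state, so π can be
replaced there by a maximizer of q without lowering the mean of q in any world state. Pairing with
the stationary distribution of the new policy cancels h, so the reward has not dropped. A policy
that is deterministic off U lies in a face of dimension |U|(|A|-1) (`isStochastic_of_eq_single`).

For sharpness, world states ι(s,a) remember the last action, and repeating it is penalized. With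
restarts in ν the stationary reward becomes -λ ∑ ν_s ∑ π(a|s)², where ν_s is the mass of the block
ι(s,·) (`repetition_stationaryReward`). Its maximizers use every action on V (`repetition_pos`), and
a face through such a policy contains all directions supported on V in its span
(`directions_le_vectorSpan`). -/

open Filter Topology Matrix

/-! ### Stochastic matrices: Poisson equation and restarts. -/

section Stochastic

variable {W : Type*} [Fintype W]

lemma dotProduct_mem_stdSimplex_le {p h : W → ℝ} (hp : p ∈ stdSimplex ℝ W) :
    |p ⬝ᵥ h| ≤ ∑ w, |h w| := by
  refine (Finset.abs_sum_le_sum_abs _ _).trans (Finset.sum_le_sum fun w _ => ?_)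
  rw [abs_mul, abs_of_nonneg (hp.1 w)]
  exact mul_le_of_le_one_left (abs_nonneg _) (mem_Icc_of_mem_stdSimplex hp w).2

lemma dotProduct_const_add {p : W → ℝ} (hp : p ∈ stdSimplex ℝ W) (c : ℝ) (h : W → ℝ) :
    (p ⬝ᵥ fun w => c + h w) = c + p ⬝ᵥ h := by
  simp [dotProduct, mul_add, Finset.sum_add_distrib, ← Finset.sum_mul, hp.2]

/-- Follow `P` with probability `γ`, and restart in `μ` otherwise. -/
def restartMatrix (γ : ℝ) (μ : W → ℝ) (P : Matrix W W ℝ) : Matrix W W ℝ :=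
  γ • P + (1 - γ) • vecMulVec 1 μ

lemma vecMul_restartMatrix (γ : ℝ) (μ : W → ℝ) (P : Matrix W W ℝ) {p : W → ℝ}
    (hp : p ∈ stdSimplex ℝ W) : p ᵥ* restartMatrix γ μ P = γ • (p ᵥ* P) + (1 - γ) • μ := by
  have : p ⬝ᵥ 1 = 1 := by simpa [dotProduct] using hp.2
  rw [restartMatrix, vecMul_add, vecMul_smul, vecMul_smul, vecMul_vecMulVec, this, one_smul]

variable [DecidableEq W]

lemma vecMul_mem_stdSimplex {P : Matrix W W ℝ} (hP : P ∈ rowStochastic ℝ W) {p : W → ℝ}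
    (hp : p ∈ stdSimplex ℝ W) : p ᵥ* P ∈ stdSimplex ℝ W := by
  refine ⟨nonneg_vecMul_of_mem_rowStochastic hP hp.1, ?_⟩
  have := vecMul_dotProduct_one_eq_one_rowStochastic hP (x := p) (by simpa [dotProduct] using hp.2)
  simpa [dotProduct] using this

lemma sum_vecMul {P : Matrix W W ℝ} (hP : P ∈ rowStochastic ℝ W) (v : W → ℝ) :
    ∑ w, (v ᵥ* P) w = ∑ w, v w := by
  have : (v ᵥ* P) ⬝ᵥ 1 = v ⬝ᵥ 1 := by
    rw [← dotProduct_mulVec, one_vecMul_of_mem_rowStochastic hP]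
  simpa [dotProduct] using this

/-- If the stationary distribution is unique, an invariant vector of total mass zero vanishes. -/
lemma eq_zero_of_vecMul_eq_self {P : Matrix W W ℝ} (hP : P ∈ rowStochastic ℝ W)
    (hu : ∀ p q : W → ℝ, p ∈ stdSimplex ℝ W → p ᵥ* P = p → q ∈ stdSimplex ℝ W → q ᵥ* P = q →
      p = q) {v : W → ℝ} (hv : v ᵥ* P = v) (h0 : ∑ w, v w = 0) : v = 0 := by
  -- The triangle inequality gives |v| ≤ |v|P entrywise; both sides have the same total mass, so
  -- they agree.
  have habs : |v| ᵥ* P = |v| := by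
    have hle : ∀ w ∈ Finset.univ, |v| w ≤ (|v| ᵥ* P) w := by
      intro w _
      calc |v| w = |(v ᵥ* P) w| := by rw [hv]; rfl
        _ ≤ ∑ x, |v x * P x w| := Finset.abs_sum_le_sum_abs _ _
        _ = (|v| ᵥ* P) w := Finset.sum_congr rfl fun x _ => by
          rw [abs_mul, abs_of_nonneg (hP.1 x w)]; rfl
    have := (Finset.sum_eq_sum_iff_of_le hle).1 (sum_vecMul hP _).symm
    exact funext fun w => (this w (Finset.mem_univ w)).symm
  by_contra hne
  set m : ℝ := ∑ w, |v| w with hm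
  have hpos : 0 < m := by
    obtain ⟨w, hw⟩ := Function.ne_iff.1 hne
    exact Finset.sum_pos' (fun x _ => abs_nonneg (v x)) ⟨w, Finset.mem_univ w, abs_pos.2 hw⟩
  have h1 := hu (m⁻¹ • |v|) (m⁻¹ • (|v| + v))
    ⟨fun w => mul_nonneg (inv_nonneg.2 hpos.le) (abs_nonneg (v w)), by
      simp only [Pi.smul_apply, smul_eq_mul, ← Finset.mul_sum, ← hm]
      exact inv_mul_cancel₀ hpos.ne'⟩
    (by rw [smul_vecMul, habs])
    ⟨fun w => mul_nonneg (inv_nonneg.2 hpos.le)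
      (by simpa using neg_le_iff_add_nonneg.1 (neg_abs_le (v w)) |>.trans_eq (add_comm _ _)), by
      simp only [Pi.smul_apply, Pi.add_apply, smul_eq_mul, ← Finset.mul_sum,
        Finset.sum_add_distrib, ← hm, h0, add_zero]
      exact inv_mul_cancel₀ hpos.ne'⟩
    (by rw [smul_vecMul, add_vecMul, habs, hv])
  have h2 := smul_right_injective (W → ℝ) (inv_ne_zero hpos.ne') h1
  exact hne (left_eq_add.1 h2)

/-- The Poisson equation of a stochastic matrix with a unique stationary distribution. -/
lemma exists_poisson {P : Matrix W W ℝ} (hP : P ∈ rowStochastic ℝ W)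
    (hu : ∃! p : W → ℝ, p ∈ stdSimplex ℝ W ∧ p ᵥ* P = p) (r : W → ℝ) :
    ∃ (h : W → ℝ) (c : ℝ), ∀ w, r w + (P *ᵥ h) w = c + h w := by
  obtain ⟨p, ⟨hp, hpP⟩, hup⟩ := hu
  -- The rank-one term makes 1 - P invertible: summing v - vP + (∑ v)p = 0 over the coordinates
  -- forces ∑ v = 0, so v is invariant of mass zero.
  have hinj : Function.Injective (1 - P + vecMulVec 1 p).vecMul := by
    refine (injective_iff_map_eq_zero (Matrix.vecMulLinear (1 - P + vecMulVec 1 p))).2 ?_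
    intro v hv
    have hv' : v - v ᵥ* P + (∑ w, v w) • p = 0 := by
      have := hv
      rw [vecMulLinear_apply, vecMul_add, vecMul_sub, vecMul_one, vecMul_vecMulVec] at this
      simpa [dotProduct] using this
    have h0 : ∑ w, v w = 0 := by
      have := congrArg (fun x : W → ℝ => ∑ w, x w) hv'
      simpa [Finset.sum_add_distrib, Finset.sum_sub_distrib, sum_vecMul hP, ← Finset.mul_sum, hp.2]
        using this
    rw [h0, zero_smul, add_zero, sub_eq_zero] at hv'
    exact eq_zero_of_vecMul_eq_self hP
      (fun a b ha ha' hb hb' => (hup a ⟨ha, ha'⟩).trans (hup b ⟨hb, hb'⟩).symm) hv'.symm h0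
  obtain ⟨h, hh⟩ := mulVec_surjective_iff_isUnit.2 (vecMul_injective_iff_isUnit.1 hinj) r
  refine ⟨h, p ⬝ᵥ h, fun w => ?_⟩
  have := congrFun hh w
  simp only [add_mulVec, sub_mulVec, one_mulVec, vecMulVec_mulVec, Pi.add_apply, Pi.sub_apply,
    Pi.smul_apply] at this
  simp at this
  linarith

lemma restartMatrix_mem {γ : ℝ} (h0 : 0 < γ) (h1 : γ < 1) {μ : W → ℝ} (hμ : μ ∈ stdSimplex ℝ W)
    {P : Matrix W W ℝ} (hP : P ∈ rowStochastic ℝ W) :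
    restartMatrix γ μ P ∈ rowStochastic ℝ W := by
  refine convex_rowStochastic hP ?_ h0.le (sub_nonneg.2 h1.le) (by ring)
  exact mem_rowStochastic_iff_sum.2 ⟨fun i j => by simpa [vecMulVec] using hμ.1 j,
    fun i => by simpa [vecMulVec] using hμ.2⟩

lemma pow_vecMul_mem {P : Matrix W W ℝ} (hP : P ∈ rowStochastic ℝ W) {p : W → ℝ}
    (hp : p ∈ stdSimplex ℝ W) (t : ℕ) : p ᵥ* P ^ t ∈ stdSimplex ℝ W :=
  vecMul_mem_stdSimplex (pow_mem hP t) hp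

/-- Both chains receive the same restart mass (1-γ)μ, which cancels in the difference; each step
leaves a factor γ. -/
lemma vecMul_pow_restartMatrix_sub {γ : ℝ} (h0 : 0 < γ) (h1 : γ < 1) {μ : W → ℝ}
    (hμ : μ ∈ stdSimplex ℝ W) {P : Matrix W W ℝ} (hP : P ∈ rowStochastic ℝ W) {p q : W → ℝ}
    (hp : p ∈ stdSimplex ℝ W) (hq : q ∈ stdSimplex ℝ W) (t : ℕ) :
    p ᵥ* restartMatrix γ μ P ^ t - q ᵥ* restartMatrix γ μ P ^ t =
      γ ^ t • (p ᵥ* P ^ t - q ᵥ* P ^ t) := by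
  induction t with
  | zero => simp
  | succ t ih =>
    have hR := restartMatrix_mem h0 h1 hμ hP
    rw [pow_succ, ← vecMul_vecMul, ← vecMul_vecMul, vecMul_restartMatrix _ _ _
      (pow_vecMul_mem hR hp t), vecMul_restartMatrix _ _ _ (pow_vecMul_mem hR hq t),
      add_sub_add_right_eq_sub, ← smul_sub, ← sub_vecMul, ih, smul_vecMul, sub_vecMul,
      vecMul_vecMul, vecMul_vecMul, ← pow_succ, smul_smul, ← pow_succ']

lemma tendsto_vecMul_pow_restartMatrix {γ : ℝ} (h0 : 0 < γ) (h1 : γ < 1) {μ : W → ℝ}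
    (hμ : μ ∈ stdSimplex ℝ W) {P : Matrix W W ℝ} (hP : P ∈ rowStochastic ℝ W) {p q : W → ℝ}
    (hp : p ∈ stdSimplex ℝ W) (hpP : p ᵥ* restartMatrix γ μ P = p) (hq : q ∈ stdSimplex ℝ W) :
    Tendsto (fun t : ℕ => q ᵥ* restartMatrix γ μ P ^ t) atTop (𝓝 p) := by
  have hfix : ∀ t : ℕ, p ᵥ* restartMatrix γ μ P ^ t = p := fun t => by
    induction t with
    | zero => simp
    | succ t ih => rw [pow_succ, ← vecMul_vecMul, ih, hpP]
  rw [tendsto_iff_norm_sub_tendsto_zero]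
  refine squeeze_zero (fun _ => norm_nonneg _) (g := fun t => γ ^ t * 2) (fun t => ?_) ?_
  · have h := vecMul_pow_restartMatrix_sub h0 h1 hμ hP hq hp t
    rw [hfix] at h
    rw [h, norm_smul, norm_pow, Real.norm_of_nonneg h0.le]
    refine mul_le_mul_of_nonneg_left ((norm_sub_le _ _).trans ?_) (by positivity)
    have h2 : ∀ x ∈ stdSimplex ℝ W, ‖x‖ ≤ 1 := fun x hx => by
      simpa using stdSimplex_subset_closedBall hx
    linarith [h2 _ (pow_vecMul_mem hP hq t), h2 _ (pow_vecMul_mem hP hp t)]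
  · simpa using (tendsto_pow_atTop_nhds_zero_of_lt_one h0.le h1).mul_const 2

/-- The discounted occupation measure (1-γ) ∑ γ^t μP^t is invariant: γP shifts the series by one
term, and the restart supplies the missing term μ. -/
lemma exists_stationary_restartMatrix {γ : ℝ} (h0 : 0 < γ) (h1 : γ < 1) {μ : W → ℝ}
    (hμ : μ ∈ stdSimplex ℝ W) {P : Matrix W W ℝ} (hP : P ∈ rowStochastic ℝ W) :
    ∃ p ∈ stdSimplex ℝ W, p ᵥ* restartMatrix γ μ P = p := by
  set g : ℕ → W → ℝ := fun t => γ ^ t • (μ ᵥ* P ^ t) with hg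
  have hx := pow_vecMul_mem hP hμ
  have hs : ∀ w, Summable fun t => g t w := fun w =>
    Summable.of_nonneg_of_le (fun t => mul_nonneg (by positivity) ((hx t).1 w))
      (fun t => mul_le_of_le_one_right (by positivity) (mem_Icc_of_mem_stdSimplex (hx t) w).2)
      (summable_geometric_of_lt_one h0.le h1)
  have h1' : 0 < 1 - γ := sub_pos.2 h1
  have hp : (fun w => (1 - γ) * ∑' t, g t w) ∈ stdSimplex ℝ W := by
    refine ⟨fun w => mul_nonneg h1'.le
      (tsum_nonneg fun t => mul_nonneg (by positivity) ((hx t).1 w)), ?_⟩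
    rw [← Finset.mul_sum, ← Summable.tsum_finsetSum fun w _ => hs w]
    simp only [hg, Pi.smul_apply, smul_eq_mul, ← Finset.mul_sum, (hx _).2, mul_one]
    rw [tsum_geometric_of_lt_one h0.le h1, mul_inv_cancel₀ h1'.ne']
  refine ⟨_, hp, ?_⟩
  rw [vecMul_restartMatrix _ _ _ hp]
  ext w
  have h3 : ((fun w => (1 - γ) * ∑' t, g t w) ᵥ* P) w * γ = (1 - γ) * ∑' t, g (t + 1) w := by
    have h4 : ∀ t, g (t + 1) w = γ * ∑ x, g t x * P x w := fun t => by
      have : g (t + 1) = γ • (g t ᵥ* P) := by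
        simp only [hg]
        rw [smul_vecMul, vecMul_vecMul, ← pow_succ, smul_smul, ← pow_succ']
      rw [this]
      rfl
    simp only [h4]
    rw [tsum_mul_left, Summable.tsum_finsetSum fun x _ => (hs x).mul_right _]
    simp only [tsum_mul_right, vecMul, dotProduct, Finset.mul_sum, Finset.sum_mul]
    exact Finset.sum_congr rfl fun x _ => by ring
  have h5 := (hs w).tsum_eq_zero_add
  have h6 : g 0 w = μ w := by simp [hg]
  simp only [Pi.add_apply, Pi.smul_apply, smul_eq_mul]
  rw [mul_comm, h3, h5, h6]
  ring

end Stochastic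

/-! ### The policy polytope and expectations over trajectories. -/

lemma single_mem_policyPolytope {S A : Type*} [Fintype A] [DecidableEq A] (g : S → A) :
    (fun s => Pi.single (g s) 1) ∈ policyPolytope S A :=
  fun s => single_mem_stdSimplex ℝ (g s)

lemma isCompact_policyPolytope (S A : Type*) [Fintype A] : IsCompact (policyPolytope S A) := by
  have : policyPolytope S A = Set.univ.pi fun _ => stdSimplex ℝ A := by
    ext; simp [policyPolytope]
  rw [this]
  exact isCompact_univ_pi fun _ => isCompact_stdSimplex ℝ A

namespace POMDP

variable {W S A : Type*} [Fintype W] [Fintype S]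

/-- Splitting off the first step leaves a trajectory with start distribution α(·|x), so later
inductions on the length run over all start distributions. -/
lemma trajProb_cons (M : POMDP W S A) (π : S → A → ℝ) (μ : W → ℝ) {n : ℕ} (x : W × A)
    (h : Fin (n + 1) → W × A) :
    M.trajProb π μ (Fin.cons x h : Fin (n + 2) → W × A) =
      μ x.1 * M.actionProb π x.1 x.2 * M.trajProb π (M.α x.1 x.2) h := by
  have e : ∀ t : Fin n, (Fin.cons x h : Fin (n + 2) → W × A) t.succ.castSucc = h t.castSucc :=
    fun t => by rw [← Fin.succ_castSucc, Fin.cons_succ]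
  have e' := Fin.prod_univ_succ fun t : Fin (n + 1) =>
    M.α ((Fin.cons x h : Fin (n + 2) → W × A) t.castSucc).1
      ((Fin.cons x h : Fin (n + 2) → W × A) t.castSucc).2
      ((Fin.cons x h : Fin (n + 2) → W × A) t.succ).1
  simp only [trajProb]
  rw [e', Fin.prod_univ_succ (n := n + 1)]
  simp only [Fin.cons_zero, Fin.cons_succ, Fin.castSucc_zero, e]
  ring

variable [Fintype A]

lemma actionProb_nonneg (M : POMDP W S A) {π : S → A → ℝ} (hπ : π ∈ policyPolytope S A)
    (w : W) (a : A) : 0 ≤ M.actionProb π w a :=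
  Finset.sum_nonneg fun s _ => mul_nonneg ((hπ s).1 a) ((M.β_mem w).1 s)

lemma sum_actionProb_mul (M : POMDP W S A) (π : S → A → ℝ) (w : W) (f : A → ℝ) :
    ∑ a, M.actionProb π w a * f a = ∑ s, M.β w s * ∑ a, π s a * f a := by
  simp only [actionProb, Finset.sum_mul, Finset.mul_sum]
  rw [Finset.sum_comm]
  exact Finset.sum_congr rfl fun s _ => Finset.sum_congr rfl fun a _ => by ring

lemma sum_actionProb (M : POMDP W S A) {π : S → A → ℝ} (hπ : π ∈ policyPolytope S A)
    (w : W) : ∑ a, M.actionProb π w a = 1 := by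
  have := M.sum_actionProb_mul π w 1
  simpa [(hπ _).2, (M.β_mem w).2] using this

/-- The expected immediate reward in each world state under the policy `π`. -/
def stateReward (M : POMDP W S A) (π : S → A → ℝ) (w : W) : ℝ :=
  ∑ a, M.actionProb π w a * M.R w a

/-- The POMDP in which the dynamics are followed with probability `γ` only, and the world state
is reset to a sample of `μ` otherwise. -/
def restart (M : POMDP W S A) {γ : ℝ} (h0 : 0 < γ) (h1 : γ < 1) {μ : W → ℝ}
    (hμ : μ ∈ stdSimplex ℝ W) : POMDP W S A where
  α w a := γ • M.α w a + (1 - γ) • μ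
  α_mem w a := convex_stdSimplex ℝ W (M.α_mem w a) hμ h0.le (sub_nonneg.2 h1.le) (by ring)
  β := M.β
  β_mem := M.β_mem
  R := M.R

lemma transition_restart (M : POMDP W S A) {γ : ℝ} (h0 : 0 < γ) (h1 : γ < 1) {μ : W → ℝ}
    (hμ : μ ∈ stdSimplex ℝ W) {π : S → A → ℝ} (hπ : π ∈ policyPolytope S A) :
    (M.restart h0 h1 hμ).transition π = restartMatrix γ μ (M.transition π) := by
  ext w w'
  have h : ∑ a, M.actionProb π w a * μ w' = μ w' := by
    rw [← Finset.sum_mul, M.sum_actionProb hπ, one_mul]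
  calc ∑ a, M.actionProb π w a * (γ * M.α w a w' + (1 - γ) * μ w')
      = γ * ∑ a, M.actionProb π w a * M.α w a w' + (1 - γ) * ∑ a, M.actionProb π w a * μ w' := by
        rw [Finset.mul_sum, Finset.mul_sum, ← Finset.sum_add_distrib]
        exact Finset.sum_congr rfl fun a _ => by ring
    _ = _ := by rw [h]; simp [restartMatrix, transition, vecMulVec]

lemma transition_mulVec (M : POMDP W S A) (π : S → A → ℝ) (h : W → ℝ) (w : W) :
    (M.transition π *ᵥ h) w = ∑ a, M.actionProb π w a * (M.α w a ⬝ᵥ h) := by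
  simp only [transition, mulVec, dotProduct, Matrix.of_apply, Finset.sum_mul, Finset.mul_sum]
  rw [Finset.sum_comm]
  exact Finset.sum_congr rfl fun s _ => Finset.sum_congr rfl fun a _ => by ring

lemma vecMul_transition (M : POMDP W S A) (π : S → A → ℝ) (μ : W → ℝ) (w' : W) :
    (μ ᵥ* M.transition π) w' = ∑ x : W × A, μ x.1 * M.actionProb π x.1 x.2 * M.α x.1 x.2 w' := by
  rw [Fintype.sum_prod_type]
  simp only [transition, vecMul, dotProduct, Matrix.of_apply, Finset.mul_sum, mul_assoc]

lemma sum_trajProb_zero (M : POMDP W S A) (π : S → A → ℝ) (μ : W → ℝ)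
    (F : (Fin 1 → W × A) → ℝ) :
    ∑ h, M.trajProb π μ h * F h =
      ∑ x : W × A, μ x.1 * M.actionProb π x.1 x.2 * F fun _ => x := by
  rw [← (Equiv.funUnique (Fin 1) (W × A)).symm.sum_comp]
  simp [trajProb, Equiv.funUnique]
  rfl

lemma sum_trajProb_succ (M : POMDP W S A) (π : S → A → ℝ) (μ : W → ℝ) {n : ℕ}
    (F : (Fin (n + 2) → W × A) → ℝ) :
    ∑ h, M.trajProb π μ h * F h = ∑ x : W × A, μ x.1 * M.actionProb π x.1 x.2 *
      ∑ h : Fin (n + 1) → W × A, M.trajProb π (M.α x.1 x.2) h * F (Fin.cons x h) := by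
  rw [← (Fin.consEquiv fun _ : Fin (n + 2) => W × A).sum_comp, Fintype.sum_prod_type]
  refine Finset.sum_congr rfl fun x _ => ?_
  rw [Finset.mul_sum]
  refine Finset.sum_congr rfl fun h _ => ?_
  change M.trajProb π μ (Fin.cons x h : Fin (n + 2) → W × A) * F (Fin.cons x h) = _
  rw [trajProb_cons, mul_assoc]

lemma sum_trajProb (M : POMDP W S A) {π : S → A → ℝ} (hπ : π ∈ policyPolytope S A) (n : ℕ)
    {μ : W → ℝ} (hμ : μ ∈ stdSimplex ℝ W) :
    ∑ h : Fin (n + 1) → W × A, M.trajProb π μ h = 1 := by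
  have key : ∑ x : W × A, μ x.1 * M.actionProb π x.1 x.2 = 1 := by
    rw [Fintype.sum_prod_type]
    simp [← Finset.mul_sum, M.sum_actionProb hπ, hμ.2]
  induction n generalizing μ with
  | zero =>
    have := M.sum_trajProb_zero π μ fun _ => 1
    simp only [mul_one] at this
    exact this.trans key
  | succ n ih =>
    have := M.sum_trajProb_succ π μ (n := n) fun _ => 1
    simp only [mul_one] at this
    refine this.trans (Eq.trans (Finset.sum_congr rfl fun x _ => ?_) key)
    rw [ih (M.α_mem _ _), mul_one]
    rw [Fintype.sum_prod_type]
    simp [← Finset.mul_sum, M.sum_actionProb hπ, (M.α_mem _ _).2]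

variable [DecidableEq W]

lemma transition_mem (M : POMDP W S A) {π : S → A → ℝ} (hπ : π ∈ policyPolytope S A) :
    M.transition π ∈ rowStochastic ℝ W := by
  refine mem_rowStochastic_iff_sum.2 ⟨fun w w' => Finset.sum_nonneg fun a _ =>
    mul_nonneg (M.actionProb_nonneg hπ w a) ((M.α_mem w a).1 w'), fun w => ?_⟩
  have := M.transition_mulVec π 1 w
  simp only [mulVec, dotProduct, Pi.one_apply, mul_one, (M.α_mem w _).2, M.sum_actionProb hπ]
    at this
  exact this

/-- The expected reward at a given time, in terms of the powers of the transition matrix. -/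
lemma expect_reward (M : POMDP W S A) {π : S → A → ℝ} (hπ : π ∈ policyPolytope S A) (n : ℕ)
    {μ : W → ℝ} (hμ : μ ∈ stdSimplex ℝ W) (t : Fin (n + 1)) :
    (M.expect π μ n fun h => M.R (h t).1 (h t).2) =
      (μ ᵥ* M.transition π ^ (t : ℕ)) ⬝ᵥ M.stateReward π := by
  have key (μ : W → ℝ) : ∑ x : W × A, μ x.1 * M.actionProb π x.1 x.2 * M.R x.1 x.2 =
      μ ⬝ᵥ M.stateReward π := by
    rw [Fintype.sum_prod_type]
    simp [stateReward, dotProduct, Finset.mul_sum, mul_assoc]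
  induction n generalizing μ with
  | zero =>
    obtain rfl : t = 0 := Fin.fin_one_eq_zero t
    simp only [expect, sum_trajProb_zero, key, Fin.val_zero, pow_zero, vecMul_one]
  | succ n ih =>
    simp only [expect, sum_trajProb_succ]
    refine Fin.cases ?_ (fun t => ?_) t
    · simp only [Fin.cons_zero, ← Finset.sum_mul, M.sum_trajProb hπ n (M.α_mem _ _), one_mul,
        Fin.val_zero, pow_zero, vecMul_one, key]
    · simp only [Fin.cons_succ, Fin.val_succ]
      have h2 : ∀ x : W × A, _ = M.α x.1 x.2 ⬝ᵥ (M.transition π ^ (t : ℕ) *ᵥ M.stateReward π) :=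
        fun x => (ih (M.α_mem x.1 x.2) t).trans (dotProduct_mulVec _ _ _).symm
      simp only [expect] at h2
      simp only [h2]
      rw [pow_succ', ← vecMul_vecMul, ← dotProduct_mulVec]
      simp only [dotProduct, vecMul_transition, Finset.mul_sum, Finset.sum_mul]
      rw [Finset.sum_comm]
      exact Finset.sum_congr rfl fun s _ => Finset.sum_congr rfl fun a _ => by ring

lemma expect_sum (M : POMDP W S A) {π : S → A → ℝ} (hπ : π ∈ policyPolytope S A) (n : ℕ)
    {μ : W → ℝ} (hμ : μ ∈ stdSimplex ℝ W) (c : ℕ → ℝ) :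
    (M.expect π μ n fun h => ∑ t : Fin (n + 1), c t * M.R (h t).1 (h t).2) =
      ∑ t ∈ Finset.range (n + 1), c t * ((μ ᵥ* M.transition π ^ t) ⬝ᵥ M.stateReward π) := by
  rw [← Fin.sum_univ_eq_sum_range fun t => c t *
    ((μ ᵥ* M.transition π ^ t) ⬝ᵥ M.stateReward π)]
  simp only [← M.expect_reward hπ n hμ, expect, Finset.mul_sum]
  rw [Finset.sum_comm]
  exact Finset.sum_congr rfl fun s _ => Finset.sum_congr rfl fun a _ => by ring

end POMDP

/-! ### Faces of the policy polytope. -/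

section Faces

variable {S A : Type*} [Fintype A]

/-- The functional on `A → ℝ` that sums the coordinates. -/
def coordSum (A : Type*) [Fintype A] : (A → ℝ) →ₗ[ℝ] ℝ := Fintype.linearCombination ℝ fun _ => 1

lemma coordSum_apply (x : A → ℝ) : coordSum A x = ∑ a, x a := by
  simp [coordSum, Fintype.linearCombination_apply]

lemma finrank_ker_coordSum [Nonempty A] :
    Module.finrank ℝ (LinearMap.ker (coordSum A)) = Fintype.card A - 1 := by
  classical
  have h : coordSum A ≠ 0 := fun h => by
    have := congrArg (fun f => f (Pi.single (Classical.arbitrary A) 1)) h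
    simp [coordSum_apply] at this
  have := Module.Dual.finrank_ker_add_one_of_ne_zero h
  rw [Module.finrank_fintype_fun_eq_card] at this
  omega

open Classical in
/-- Extension by zero of a family of vectors of coordinate sum zero. -/
noncomputable def extendDirections (A : Type*) [Fintype A] (V : Set S) :
    (V → LinearMap.ker (coordSum A)) →ₗ[ℝ] (S → A → ℝ) where
  toFun v s := if h : s ∈ V then (v ⟨s, h⟩ : A → ℝ) else 0
  map_add' v v' := by ext s a; by_cases h : s ∈ V <;> simp [h]
  map_smul' c v := by ext s a; by_cases h : s ∈ V <;> simp [h]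

/-- The directions of the policy polytope that are supported on the sensor states in `V`. -/
noncomputable def directions (A : Type*) [Fintype A] (V : Set S) : Submodule ℝ (S → A → ℝ) :=
  LinearMap.range (extendDirections A V)

lemma mem_directions {V : Set S} {v : S → A → ℝ} :
    v ∈ directions A V ↔ (∀ s ∉ V, v s = 0) ∧ ∀ s, ∑ a, v s a = 0 := by
  constructor
  · rintro ⟨u, rfl⟩
    refine ⟨fun s hs => by simp [extendDirections, hs], fun s => ?_⟩
    by_cases h : s ∈ V
    · have := (u ⟨s, h⟩).2
      rw [LinearMap.mem_ker, coordSum_apply] at this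
      simpa [extendDirections, h] using this
    · simp [extendDirections, h]
  · rintro ⟨h0, h1⟩
    refine ⟨fun s => ⟨v s, by rw [LinearMap.mem_ker, coordSum_apply, h1]⟩, ?_⟩
    ext s a
    by_cases h : s ∈ V
    · simp [extendDirections, h]
    · simp [extendDirections, h, h0 s h]

variable [Fintype S]

lemma finrank_directions [Nonempty A] (V : Set S) :
    Module.finrank ℝ (directions A V) = V.ncard * (Fintype.card A - 1) := by
  classical
  have hinj : Function.Injective (extendDirections A V) := by
    intro u u' h
    funext s
    have := congrFun h s
    simpa [extendDirections] using this
  rw [directions, LinearMap.finrank_range_of_inj hinj, Module.finrank_pi_fintype]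
  simp only [finrank_ker_coordSum, Finset.sum_const, smul_eq_mul, Finset.card_univ]
  rw [← Nat.card_eq_fintype_card, Nat.card_coe_set_eq]

/-- Positivity on V keeps π ± εv in the polytope for small ε. The exposing functional is maximal at
π, hence vanishes on v, so π + εv lies in the face too. -/
lemma directions_le_vectorSpan {V : Set S} {F : Set (S → A → ℝ)}
    (hF : IsExposed ℝ (policyPolytope S A) F) {π : S → A → ℝ} (hπ : π ∈ F)
    (hpos : ∀ s ∈ V, ∀ a, 0 < π s a) : directions A V ≤ vectorSpan ℝ F := by
  intro v hv
  obtain ⟨h0, h1⟩ := mem_directions.1 hv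
  obtain ⟨l, rfl⟩ := hF ⟨π, hπ⟩
  have hev : ∀ᶠ ε : ℝ in 𝓝 0, π + ε • v ∈ policyPolytope S A := by
    have : ∀ᶠ ε : ℝ in 𝓝 0, ∀ s a, 0 ≤ π s a + ε * v s a := by
      refine eventually_all.2 fun s => eventually_all.2 fun a => ?_
      by_cases hs : s ∈ V
      · have : Tendsto (fun ε : ℝ => π s a + ε * v s a) (𝓝 0) (𝓝 (π s a + 0 * v s a)) :=
          Continuous.tendsto (by fun_prop) 0
        rw [zero_mul, add_zero] at this
        exact (this.eventually (lt_mem_nhds (hpos s hs a))).mono fun _ => le_of_lt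
      · exact Eventually.of_forall fun ε => by simpa [h0 s hs] using (hπ.1 s).1 a
    filter_upwards [this] with ε hε s
    refine ⟨hε s, ?_⟩
    simp [Finset.sum_add_distrib, ← Finset.mul_sum, h1, (hπ.1 s).2]
  have hneg : Tendsto (fun ε : ℝ => -ε) (𝓝 0) (𝓝 0) := by
    simpa using (continuous_neg (G := ℝ)).tendsto 0
  obtain ⟨ε, ⟨hε, hε'⟩, hε0⟩ :=
    (((hev.and (hneg.eventually hev)).filter_mono nhdsWithin_le_nhds).and
      (self_mem_nhdsWithin (s := Set.Ioi (0 : ℝ)))).exists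
  have e1 := hπ.2 _ hε
  have e2 := hπ.2 _ hε'
  simp only [map_add, map_smul, smul_eq_mul] at e1 e2
  have hlv : ε * l v = 0 := by linarith
  have hmem := vsub_mem_vectorSpan ℝ (s := {x ∈ policyPolytope S A | ∀ y ∈ policyPolytope S A,
    l y ≤ l x}) (p₁ := π + ε • v) (p₂ := π)
    ⟨hε, fun y hy => by simpa [hlv] using hπ.2 y hy⟩ hπ
  rw [vsub_eq_sub, add_sub_cancel_left] at hmem
  simpa [(ne_of_gt hε0 : ε ≠ 0)] using Submodule.smul_mem _ ε⁻¹ hmem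

lemma le_of_isStochastic [Nonempty A] {V : Set S} {π : S → A → ℝ}
    (hpos : ∀ s ∈ V, ∀ a, 0 < π s a) {k : ℕ} (hk : IsStochastic k π) :
    V.ncard * (Fintype.card A - 1) ≤ k := by
  obtain ⟨F, hF, hπF, rfl⟩ := hk
  rw [← finrank_directions]
  exact Submodule.finrank_mono (directions_le_vectorSpan hF hπF hpos)

/-- The functional summing x s (g s) over s ∉ U has all its terms at most 1, so its maximizers are
exactly the policies that choose g s at every s ∉ U. -/
lemma isStochastic_of_eq_single [Nonempty A] [DecidableEq A] (U : Set S) {π : S → A → ℝ}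
    (hπ : π ∈ policyPolytope S A) (g : S → A) (hg : ∀ s ∉ U, π s = Pi.single (g s) 1) :
    IsStochastic (U.ncard * (Fintype.card A - 1)) π := by
  classical
  set T : Finset S := Finset.univ.filter (· ∉ U) with hT
  set l : StrongDual ℝ (S → A → ℝ) := ∑ s ∈ T,
    (ContinuousLinearMap.proj (R := ℝ) (φ := fun _ : A => ℝ) (g s)).comp
      (ContinuousLinearMap.proj (R := ℝ) (φ := fun _ : S => A → ℝ) s)
    with hl
  have hlx : ∀ x, l x = ∑ s ∈ T, x s (g s) := fun x => by
    simp [hl]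
  have hle : ∀ x ∈ policyPolytope S A, ∀ s ∈ T, x s (g s) ≤ 1 := fun x hx s _ =>
    (mem_Icc_of_mem_stdSimplex (hx s) (g s)).2
  set F : Set (S → A → ℝ) := {x ∈ policyPolytope S A | ∀ y ∈ policyPolytope S A, l y ≤ l x}
  have hF : IsExposed ℝ (policyPolytope S A) F := fun _ => ⟨l, rfl⟩
  have hmem : ∀ x ∈ policyPolytope S A, (∀ s ∉ U, x s = Pi.single (g s) 1) → x ∈ F := by
    refine fun x hx hxg => ⟨hx, fun y hy => ?_⟩
    rw [hlx, hlx]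
    refine Finset.sum_le_sum fun s hs => (hle y hy s hs).trans_eq ?_
    rw [hxg s (Finset.mem_filter.1 hs).2, Pi.single_eq_same]
  have hmem' : ∀ x ∈ F, ∀ s ∉ U, x s = Pi.single (g s) 1 := by
    intro x hx s hs
    have h1 := hx.2 π hπ
    rw [hlx, hlx] at h1
    have h2 : ∑ s ∈ T, π s (g s) = ∑ s ∈ T, 1 := Finset.sum_congr rfl fun s hs => by
      rw [hg s (Finset.mem_filter.1 hs).2, Pi.single_eq_same]
    have h3 : x s (g s) = 1 := (Finset.sum_eq_sum_iff_of_le (hle x hx.1)).1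
      (le_antisymm (Finset.sum_le_sum (hle x hx.1)) (h2 ▸ h1)) s (by simp [hT, hs])
    have h4 := (hx.1 s).2
    rw [← Finset.add_sum_erase _ _ (Finset.mem_univ (g s)), h3, add_eq_left,
      Finset.sum_eq_zero_iff_of_nonneg fun a _ => (hx.1 s).1 a] at h4
    funext a
    by_cases ha : a = g s
    · rw [ha, h3, Pi.single_eq_same]
    · rw [Pi.single_eq_of_ne ha, h4 a (by simp [ha])]
  refine ⟨F, hF, hmem π hπ hg, ?_⟩
  rw [← finrank_directions (A := A) U]
  suffices h : vectorSpan ℝ F = directions A U by rw [h]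
  refine le_antisymm (Submodule.span_le.2 ?_) ?_
  · rintro _ ⟨x, hx, y, hy, rfl⟩
    refine mem_directions.2 ⟨fun s hs => ?_, fun s => ?_⟩
    · simp [hmem' x hx s hs, hmem' y hy s hs]
    · simp [Finset.sum_sub_distrib, (hx.1 s).2, (hy.1 s).2]
  -- The given π may lie on the boundary at U; making it uniform there gives a point of the face
  -- with positive entries on U.
  · have hc : (0 : ℝ) < Fintype.card A := Nat.cast_pos.2 Fintype.card_pos
    refine directions_le_vectorSpan hF (π := fun s => if s ∈ U then fun _ => (Fintype.card A : ℝ)⁻¹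
      else π s) (hmem _ (fun s => ?_) fun s hs => by simp [hs, hg]) fun s hs a => by simp [hs, hc]
    by_cases hs : s ∈ U
    · simp only [hs, if_true]
      exact ⟨fun _ => (inv_pos.2 hc).le, by simp⟩
    · simpa [hs] using hπ s

end Faces

/-! ### Average and discounted rewards as stationary rewards. -/

namespace POMDP

variable {W S A : Type*} [Fintype W] [Fintype S] [Fintype A] [DecidableEq W]

lemma exists_poisson_transition (M : POMDP W S A) (hM : M.UniqueStationary) {π : S → A → ℝ}
    (hπ : π ∈ policyPolytope S A) {p : W → ℝ} (hp : M.IsStationary π p) :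
    ∃ h : W → ℝ, ∀ w, M.stateReward π w + (M.transition π *ᵥ h) w =
      p ⬝ᵥ M.stateReward π + h w := by
  obtain ⟨h, c, hc⟩ := exists_poisson (M.transition_mem hπ) (hM π hπ) (M.stateReward π)
  -- Pairing the Poisson equation with p cancels h and identifies the constant.
  have h1 : p ⬝ᵥ (M.stateReward π + M.transition π *ᵥ h) = p ⬝ᵥ (fun w => c + h w) :=
    congrArg _ (funext hc)
  rw [dotProduct_add, dotProduct_mulVec, hp.2] at h1
  have h2 := dotProduct_const_add hp.1 c h
  refine ⟨h, fun w => ?_⟩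
  rw [hc]
  linarith

/-- By the Poisson equation each expected reward is c plus a telescoping difference, so the time
average is c plus a bounded quantity divided by the number of steps. -/
lemma isAverageReward (M : POMDP W S A) (hM : M.UniqueStationary) {π : S → A → ℝ}
    (hπ : π ∈ policyPolytope S A) {p : W → ℝ} (hp : M.IsStationary π p) {μ : W → ℝ}
    (hμ : μ ∈ stdSimplex ℝ W) : M.IsAverageReward μ π (p ⬝ᵥ M.stateReward π) := by
  obtain ⟨h, hh⟩ := M.exists_poisson_transition hM hπ hp
  set P := M.transition π
  set c := p ⬝ᵥ M.stateReward π
  have hx : ∀ t, μ ᵥ* P ^ t ∈ stdSimplex ℝ W := pow_vecMul_mem (M.transition_mem hπ) hμ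
  have step : ∀ t : ℕ, (μ ᵥ* P ^ t) ⬝ᵥ M.stateReward π =
      c + ((μ ᵥ* P ^ t) ⬝ᵥ h - (μ ᵥ* P ^ (t + 1)) ⬝ᵥ h) := fun t => by
    have h1 : (μ ᵥ* P ^ t) ⬝ᵥ (M.stateReward π + P *ᵥ h) = (μ ᵥ* P ^ t) ⬝ᵥ (fun w => c + h w) :=
      congrArg _ (funext hh)
    have h2 := dotProduct_const_add (hx t) c h
    rw [dotProduct_add, dotProduct_mulVec, vecMul_vecMul, ← pow_succ, h2] at h1
    linarith
  have hsum : ∀ n : ℕ, (M.expect π μ n fun h => (1 / ((n : ℝ) + 1)) * ∑ t, M.R (h t).1 (h t).2) =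
      c + (μ ⬝ᵥ h - (μ ᵥ* P ^ (n + 1)) ⬝ᵥ h) * (1 / ((n : ℝ) + 1)) := fun n => by
    have h2 : (0 : ℝ) < n + 1 := by positivity
    simp only [Finset.mul_sum]
    rw [M.expect_sum hπ n hμ fun _ => 1 / ((n : ℝ) + 1), ← Finset.mul_sum]
    change _ * ∑ t ∈ _, (μ ᵥ* P ^ t) ⬝ᵥ _ = _
    simp only [step]
    rw [Finset.sum_add_distrib, Finset.sum_range_sub' fun t => (μ ᵥ* P ^ t) ⬝ᵥ h]
    simp
    field_simp
  unfold IsAverageReward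
  simp only [hsum]
  rw [show 𝓝 c = 𝓝 (c + 0) by rw [add_zero]]
  refine tendsto_const_nhds.add (bdd_le_mul_tendsto_zero' (2 * ∑ w, |h w|)
    (Eventually.of_forall fun n => ?_) tendsto_one_div_add_atTop_nhds_zero_nat)
  have h1 := dotProduct_mem_stdSimplex_le hμ (h := h)
  have h2 := dotProduct_mem_stdSimplex_le (hx (n + 1)) (h := h)
  rw [abs_le] at *
  constructor <;> linarith

lemma uniqueStationary_of_attains (M : POMDP W S A) (hM : M.AttainsStationary)
    (he : ∀ π ∈ policyPolytope S A, ∃ p, M.IsStationary π p) : M.UniqueStationary := by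
  intro π hπ
  obtain ⟨p, hp⟩ := he π hπ
  refine ⟨p, hp, fun q hq => ?_⟩
  have h := hM π hπ p hp q hq.1
  have hfix : ∀ t : ℕ, q ᵥ* M.transition π ^ t = q := fun t => by
    induction t with
    | zero => simp
    | succ t ih => rw [pow_succ, ← vecMul_vecMul, ih, hq.2]
  simp only [hfix] at h
  exact tendsto_nhds_unique tendsto_const_nhds h

section Restart

variable (M : POMDP W S A) {γ : ℝ} (h0 : 0 < γ) (h1 : γ < 1) {μ : W → ℝ} (hμ : μ ∈ stdSimplex ℝ W)

lemma attainsStationary_restart : (M.restart h0 h1 hμ).AttainsStationary := by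
  intro π hπ p hp q hq
  obtain ⟨hp, hpP⟩ := hp
  rw [transition_restart _ _ _ _ hπ] at hpP ⊢
  exact tendsto_vecMul_pow_restartMatrix h0 h1 hμ (M.transition_mem hπ) hp hpP hq

lemma uniqueStationary_restart : (M.restart h0 h1 hμ).UniqueStationary :=
  uniqueStationary_of_attains _ (M.attainsStationary_restart h0 h1 hμ) fun π hπ => by
    obtain ⟨p, hp⟩ := exists_stationary_restartMatrix h0 h1 hμ (M.transition_mem hπ)
    refine ⟨p, hp.1, ?_⟩
    rw [transition_restart _ _ _ _ hπ]
    exact hp.2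

/-- The Poisson equation of the restarted chain reads r + γPh = b + h with b = c - (1-γ) μ·h. The
weighted rewards therefore telescope up to a geometric series in b, and b/(1-γ) + μ·h = c/(1-γ). -/
lemma isDiscountedReward {π : S → A → ℝ} (hπ : π ∈ policyPolytope S A) {p : W → ℝ}
    (hp : (M.restart h0 h1 hμ).IsStationary π p) :
    M.IsDiscountedReward γ μ π ((p ⬝ᵥ M.stateReward π) / (1 - γ)) := by
  obtain ⟨h, hh⟩ := exists_poisson_transition _ (M.uniqueStationary_restart h0 h1 hμ) hπ hp
  rw [transition_restart _ _ _ _ hπ] at hh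
  change ∀ w, M.stateReward π w + _ = p ⬝ᵥ M.stateReward π + h w at hh
  set P := M.transition π
  set c := p ⬝ᵥ M.stateReward π
  have hx : ∀ t, μ ᵥ* P ^ t ∈ stdSimplex ℝ W := pow_vecMul_mem (M.transition_mem hπ) hμ
  have h1' : 0 < 1 - γ := sub_pos.2 h1
  set b := c - (1 - γ) * (μ ⬝ᵥ h)
  have step : ∀ t : ℕ, γ ^ t * ((μ ᵥ* P ^ t) ⬝ᵥ M.stateReward π) =
      γ ^ t * b + (γ ^ t * ((μ ᵥ* P ^ t) ⬝ᵥ h) - γ ^ (t + 1) * ((μ ᵥ* P ^ (t + 1)) ⬝ᵥ h)) := by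
    intro t
    have e1 : (μ ᵥ* P ^ t) ⬝ᵥ (M.stateReward π + restartMatrix γ μ P *ᵥ h) =
      (μ ᵥ* P ^ t) ⬝ᵥ (fun w => c + h w) := congrArg _ (funext hh)
    have e2 := dotProduct_const_add (hx t) c h
    rw [dotProduct_add, dotProduct_mulVec, vecMul_restartMatrix _ _ _ (hx t), vecMul_vecMul,
      ← pow_succ, e2, add_dotProduct, smul_dotProduct, smul_dotProduct, smul_eq_mul,
      smul_eq_mul] at e1
    rw [eq_sub_of_add_eq e1]
    ring
  have hsum : ∀ n : ℕ, (M.expect π μ n fun h => ∑ t : Fin (n + 1),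
      γ ^ (t : ℕ) * M.R (h t).1 (h t).2) = (∑ t ∈ Finset.range (n + 1), γ ^ t) * b +
        (μ ⬝ᵥ h - ((μ ᵥ* P ^ (n + 1)) ⬝ᵥ h) * γ ^ (n + 1)) := fun n => by
    rw [M.expect_sum hπ n hμ fun t => γ ^ t]
    change ∑ t ∈ _, γ ^ t * ((μ ᵥ* P ^ t) ⬝ᵥ _) = _
    simp only [step]
    rw [Finset.sum_add_distrib, Finset.sum_range_sub' fun t => γ ^ t * ((μ ᵥ* P ^ t) ⬝ᵥ h),
      ← Finset.sum_mul]
    simp [mul_comm]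
  unfold IsDiscountedReward
  simp only [hsum]
  have hlim : c / (1 - γ) = (1 - γ)⁻¹ * b + (μ ⬝ᵥ h - 0) := by
    simp only [b]; field_simp; ring
  rw [hlim]
  refine Tendsto.add (Tendsto.mul_const _ ?_) (tendsto_const_nhds.sub ?_)
  · exact (tendsto_add_atTop_iff_nat 1).2 (hasSum_geometric_of_lt_one h0.le h1).tendsto_sum_nat
  · refine bdd_le_mul_tendsto_zero' (∑ w, |h w|)
      (Eventually.of_forall fun n => dotProduct_mem_stdSimplex_le (hx (n + 1)))
      ((tendsto_add_atTop_iff_nat 1).2 (tendsto_pow_atTop_nhds_zero_of_lt_one h0.le h1))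

end Restart

end POMDP

/-! ### Existence of optimal policies that are deterministic off U. -/

namespace POMDP

variable {W S A : Type*} [Fintype W] [Fintype S] [Fintype A]

lemma sum_actionProb_mul_le (M : POMDP W S A) {π π' : S → A → ℝ} {f : A → ℝ} (w : W)
    (h : ∀ s, M.β w s ≠ 0 → ∑ a, π s a * f a ≤ ∑ a, π' s a * f a) :
    ∑ a, M.actionProb π w a * f a ≤ ∑ a, M.actionProb π' w a * f a := by
  rw [sum_actionProb_mul, sum_actionProb_mul]
  refine Finset.sum_le_sum fun s _ => ?_
  by_cases hs : M.β w s = 0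
  · simp [hs]
  · exact mul_le_mul_of_nonneg_left (h s hs) ((M.β_mem w).1 s)

/-- At an unambiguous sensor state, some action is best in all world states that produce it. -/
lemma exists_best_action [Nonempty A] (M : POMDP W S A) (q : W → A → ℝ) {s : S}
    (hs : s ∉ M.ambiguous) : ∃ a, ∀ w, M.β w s ≠ 0 → ∀ b, q w b ≤ q w a := by
  by_cases h : ∃ w, M.β w s ≠ 0
  · obtain ⟨w, hw⟩ := h
    obtain ⟨a, ha⟩ := Finite.exists_max (q w)
    have hle := (Set.ncard_le_one (Set.toFinite _)).1 (not_lt.1 hs)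
    exact ⟨a, fun w' hw' b => hle w hw w' hw' ▸ ha b⟩
  · push Not at h
    exact ⟨Classical.arbitrary A, fun w hw => absurd (h w) hw⟩

/-- Maximizing over the compact set of pairs (π, p) avoids proving that p depends continuously on π.
-/
lemma exists_maximal_stationary [Nonempty A] (M : POMDP W S A) (hM : M.UniqueStationary) :
    ∃ π ∈ policyPolytope S A, ∃ p, M.IsStationary π p ∧
      ∀ π' ∈ policyPolytope S A, ∀ p', M.IsStationary π' p' →
        p' ⬝ᵥ M.stateReward π' ≤ p ⬝ᵥ M.stateReward π := by
  classical
  set K : Set ((S → A → ℝ) × (W → ℝ)) :=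
    (policyPolytope S A ×ˢ stdSimplex ℝ W) ∩ {x | x.2 ᵥ* M.transition x.1 = x.2}
  have hK : IsCompact K := by
    refine ((isCompact_policyPolytope S A).prod (isCompact_stdSimplex ℝ W)).inter_right
      (isClosed_eq ?_ continuous_snd)
    refine continuous_pi fun w => ?_
    simp only [vecMul, dotProduct, transition, actionProb, Matrix.of_apply]
    fun_prop
  have hne : K.Nonempty := by
    have hπ := single_mem_policyPolytope fun _ : S => Classical.arbitrary A
    obtain ⟨p, hp, -⟩ := hM _ hπ
    exact ⟨(_, p), ⟨hπ, hp.1⟩, hp.2⟩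
  obtain ⟨⟨π, p⟩, ⟨⟨hπ, hp⟩, hpP⟩, hmax⟩ := hK.exists_isMaxOn hne
    (f := fun x => x.2 ⬝ᵥ M.stateReward x.1) (by
      refine Continuous.continuousOn ?_
      simp only [dotProduct, stateReward, actionProb]
      fun_prop)
  exact ⟨π, hπ, p, ⟨hp, hpP⟩, fun π' hπ' p' hp' => isMaxOn_iff.1 hmax (π', p')
    ⟨⟨hπ', hp'.1⟩, hp'.2⟩⟩

variable [DecidableEq W]

/-- Among the policies with maximal stationary reward there is one that is deterministic at the
unambiguous sensor states. -/
lemma exists_maximal_isStochastic [Nonempty A] (M : POMDP W S A) (hM : M.UniqueStationary) :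
    ∃ π ∈ policyPolytope S A, ∃ p, M.IsStationary π p ∧
      (∀ π' ∈ policyPolytope S A, ∀ p', M.IsStationary π' p' →
        p' ⬝ᵥ M.stateReward π' ≤ p ⬝ᵥ M.stateReward π) ∧
      IsStochastic (M.ambiguous.ncard * (Fintype.card A - 1)) π := by
  classical
  obtain ⟨π, hπ, p, hp, hmax⟩ := M.exists_maximal_stationary hM
  obtain ⟨h, hh⟩ := M.exists_poisson_transition hM hπ hp
  set q : W → A → ℝ := fun w a => M.R w a + M.α w a ⬝ᵥ h
  have hq : ∀ (π : S → A → ℝ) w, ∑ a, M.actionProb π w a * q w a =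
      M.stateReward π w + (M.transition π *ᵥ h) w := fun π w => by
    rw [transition_mulVec, stateReward, ← Finset.sum_add_distrib]
    exact Finset.sum_congr rfl fun a _ => mul_add _ _ _
  have hbest : ∀ s, ∃ a, s ∉ M.ambiguous → ∀ w, M.β w s ≠ 0 → ∀ b, q w b ≤ q w a := fun s => by
    by_cases hs : s ∈ M.ambiguous
    · exact ⟨Classical.arbitrary A, fun h => absurd hs h⟩
    · exact (M.exists_best_action q hs).imp fun a ha _ => ha
  choose g hg using hbest
  set π' : S → A → ℝ := fun s => if s ∈ M.ambiguous then π s else Pi.single (g s) 1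
  have hπ' : π' ∈ policyPolytope S A := fun s => by
    by_cases hs : s ∈ M.ambiguous
    · simpa [π', hs] using hπ s
    · simpa [π', hs] using single_mem_stdSimplex ℝ (g s)
  obtain ⟨p', hp', -⟩ := hM π' hπ'
  have hle : p ⬝ᵥ M.stateReward π ≤ p' ⬝ᵥ M.stateReward π' := by
    -- The improvement holds in every world state with the same h; p' is invariant under the new
    -- transition matrix, so p'·h cancels below.
    have h1 : p' ⬝ᵥ (fun w => p ⬝ᵥ M.stateReward π + h w) ≤
        p' ⬝ᵥ (M.stateReward π' + M.transition π' *ᵥ h) := by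
      refine Finset.sum_le_sum fun w _ => mul_le_mul_of_nonneg_left ?_ (hp'.1.1 w)
      rw [Pi.add_apply]
      beta_reduce
      rw [← hh, ← hq, ← hq]
      refine M.sum_actionProb_mul_le w fun s hs => ?_
      by_cases hsU : s ∈ M.ambiguous
      · simp [π', hsU]
      · calc ∑ a, π s a * q w a ≤ ∑ a, π s a * q w (g s) :=
              Finset.sum_le_sum fun a _ => mul_le_mul_of_nonneg_left (hg s hsU w hs a) ((hπ s).1 a)
          _ = ∑ a, π' s a * q w a := by
              rw [← Finset.sum_mul, (hπ s).2]
              simp [π', hsU, Pi.single_apply]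
    rw [dotProduct_const_add hp'.1, dotProduct_add, dotProduct_mulVec, hp'.2] at h1
    linarith
  refine ⟨π', hπ', p', hp', fun π₁ h₁ p₁ hp₁ => (hmax π₁ h₁ p₁ hp₁).trans hle, ?_⟩
  exact isStochastic_of_eq_single _ hπ' g fun s hs => by simp [π', hs]

lemma exists_isOptimalAverage [Nonempty A] (M : POMDP W S A) (hM : M.UniqueStationary) :
    ∃ π, M.IsOptimalAverage π ∧ IsStochastic (M.ambiguous.ncard * (Fintype.card A - 1)) π := by
  obtain ⟨π, hπ, p, hp, hmax, hS⟩ := M.exists_maximal_isStochastic hM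
  refine ⟨π, ⟨hπ, fun μ hμ => ⟨_, M.isAverageReward hM hπ hp hμ, fun π' hπ' => ?_⟩⟩, hS⟩
  obtain ⟨p', hp', -⟩ := hM π' hπ'
  exact ⟨_, M.isAverageReward hM hπ' hp' hμ, hmax π' hπ' p' hp'⟩

lemma exists_isOptimalDiscounted [Nonempty A] (M : POMDP W S A) {γ : ℝ} (h0 : 0 < γ) (h1 : γ < 1)
    {μ : W → ℝ} (hμ : μ ∈ stdSimplex ℝ W) :
    ∃ π, M.IsOptimalDiscounted γ μ π ∧
      IsStochastic (M.ambiguous.ncard * (Fintype.card A - 1)) π := by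
  have hM := M.uniqueStationary_restart h0 h1 hμ
  obtain ⟨π, hπ, p, hp, hmax, hS⟩ := exists_maximal_isStochastic _ hM
  refine ⟨π, ⟨hπ, _, M.isDiscountedReward h0 h1 hμ hπ hp, fun π' hπ' => ?_⟩, hS⟩
  obtain ⟨p', hp', -⟩ := hM π' hπ'
  exact ⟨_, M.isDiscountedReward h0 h1 hμ hπ' hp',
    div_le_div_of_nonneg_right (hmax π' hπ' p' hp') (sub_nonneg.2 h1.le)⟩

lemma IsOptimalAverage.stationary_le {M : POMDP W S A} (hM : M.UniqueStationary)
    {π : S → A → ℝ} (ho : M.IsOptimalAverage π) {p : W → ℝ} (hp : M.IsStationary π p)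
    {π' : S → A → ℝ} (hπ' : π' ∈ policyPolytope S A) {p' : W → ℝ} (hp' : M.IsStationary π' p') :
    p' ⬝ᵥ M.stateReward π' ≤ p ⬝ᵥ M.stateReward π := by
  obtain ⟨r, hr, hmax⟩ := ho.2 p hp.1
  obtain ⟨r', hr', hle⟩ := hmax π' hπ'
  rwa [tendsto_nhds_unique hr (M.isAverageReward hM ho.1 hp hp.1),
    tendsto_nhds_unique hr' (M.isAverageReward hM hπ' hp' hp.1)] at hle

lemma IsOptimalDiscounted.stationary_le {M : POMDP W S A} {γ : ℝ} (h0 : 0 < γ) (h1 : γ < 1)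
    {μ : W → ℝ} (hμ : μ ∈ stdSimplex ℝ W) {π : S → A → ℝ} (ho : M.IsOptimalDiscounted γ μ π)
    {p : W → ℝ} (hp : (M.restart h0 h1 hμ).IsStationary π p)
    {π' : S → A → ℝ} (hπ' : π' ∈ policyPolytope S A) {p' : W → ℝ}
    (hp' : (M.restart h0 h1 hμ).IsStationary π' p') :
    p' ⬝ᵥ M.stateReward π' ≤ p ⬝ᵥ M.stateReward π := by
  obtain ⟨r, hr, hmax⟩ := ho.2
  obtain ⟨r', hr', hle⟩ := hmax π' hπ'
  rw [tendsto_nhds_unique hr (M.isDiscountedReward h0 h1 hμ ho.1 hp),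
    tendsto_nhds_unique hr' (M.isDiscountedReward h0 h1 hμ hπ' hp')] at hle
  exact (div_le_div_iff_of_pos_right (sub_pos.2 h1)).1 hle

end POMDP

/-! ### Sharpness: penalized repetition of actions. -/

lemma inv_card_mem_stdSimplex (A : Type*) [Fintype A] [Nonempty A] :
    (fun _ => (Fintype.card A : ℝ)⁻¹) ∈ stdSimplex ℝ A :=
  ⟨fun _ => inv_nonneg.2 (Nat.cast_nonneg _), by simp⟩

lemma sum_sq_eq_of_mem_stdSimplex {A : Type*} [Fintype A] [Nonempty A] {x : A → ℝ}
    (hx : x ∈ stdSimplex ℝ A) : ∑ a, x a ^ 2 =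
      (Fintype.card A : ℝ)⁻¹ + ∑ a, (x a - (Fintype.card A : ℝ)⁻¹) ^ 2 := by
  have hc : (Fintype.card A : ℝ) ≠ 0 := Nat.cast_ne_zero.2 Fintype.card_ne_zero
  simp only [sub_sq, Finset.sum_add_distrib, Finset.sum_sub_distrib, ← Finset.sum_mul,
    ← Finset.mul_sum, hx.2, Finset.sum_const, Finset.card_univ, nsmul_eq_mul]
  field_simp
  ring

namespace POMDP

section RecordAction

variable {W S A : Type*} (V : Set S) (ι : V × A → W)

open Classical in
/-- The world state `ι (s, a')` is followed by `ι (s, a)` when the action `a` is taken, so that it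
records the last action; world states outside the range of `ι` do not change. -/
noncomputable def recordAction (w : W) (a : A) : W :=
  if h : ∃ x, ι x = w then ι (h.choose.1, a) else w

variable {V ι}

lemma recordAction_apply (hι : Function.Injective ι) (x : V × A) (a : A) :
    recordAction V ι (ι x) a = ι (x.1, a) := by
  have h : ∃ y, ι y = ι x := ⟨x, rfl⟩
  rw [recordAction, dif_pos h, hι h.choose_spec]

end RecordAction

variable {W S A : Type*} [Fintype W] [Fintype S] [Fintype A] (V : Set S) (ι : V × A → W)

open Classical in
/-- The POMDP with deterministic dynamics `recordAction`, in which `ι (s, a')` is sensed as `s` and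
repeating the action `a'` there is penalized. The other rewards compensate the contribution of a
restart in `ν` with probability `1 - lam`. -/
noncomputable def repetition (hV : V.Nonempty) (lam : ℝ) (ν : W → ℝ) : POMDP W S A where
  α w a := Pi.single (recordAction V ι w a) 1
  α_mem w a := single_mem_stdSimplex ℝ _
  β w := if h : ∃ x, ι x = w then Pi.single (h.choose.1 : S) 1
    else fun s => if s ∈ V then (V.ncard : ℝ)⁻¹ else 0
  β_mem w := by
    split_ifs with h
    · exact single_mem_stdSimplex ℝ _
    · have hc : (0 : ℝ) < V.ncard := Nat.cast_pos.2 ((Set.ncard_pos (Set.toFinite V)).2 hV)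
      refine ⟨fun s => ?_, ?_⟩
      · dsimp only
        split_ifs
        exacts [(inv_pos.2 hc).le, le_rfl]
      · rw [Finset.sum_ite, Finset.sum_const_zero, add_zero, Finset.sum_const, nsmul_eq_mul,
          Set.filter_mem_univ_eq_toFinset, ← Set.ncard_eq_toFinset_card', mul_inv_cancel₀ hc.ne']
  R w a := if h : ∃ x, ι x = w then
      (if h.choose.2 = a then -1 else 0) +
        (1 - lam) * ν (ι (h.choose.1, a)) / ∑ b, ν (ι (h.choose.1, b))
    else 0

variable {V ι}

open Classical in
lemma repetition_β_apply (hι : Function.Injective ι) (hV : V.Nonempty) (lam : ℝ) (ν : W → ℝ)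
    (x : V × A) : (repetition V ι hV lam ν).β (ι x) = Pi.single (x.1 : S) 1 := by
  have h : ∃ y, ι y = ι x := ⟨x, rfl⟩
  simp only [repetition]
  rw [dif_pos h, hι h.choose_spec]

open Classical in
lemma repetition_β_of_notMem (hV : V.Nonempty) (lam : ℝ) (ν : W → ℝ) {w : W}
    (hw : w ∉ Set.range ι) : (repetition V ι hV lam ν).β w =
      fun s => if s ∈ V then (V.ncard : ℝ)⁻¹ else 0 :=
  dif_neg hw

open Classical in
lemma repetition_R_apply (hι : Function.Injective ι) (hV : V.Nonempty) (lam : ℝ) (ν : W → ℝ)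
    (x : V × A) (a : A) : (repetition V ι hV lam ν).R (ι x) a = (if x.2 = a then -1 else 0) +
      (1 - lam) * ν (ι (x.1, a)) / ∑ b, ν (ι (x.1, b)) := by
  have h : ∃ y, ι y = ι x := ⟨x, rfl⟩
  simp only [repetition]
  rw [dif_pos h, hι h.choose_spec]

lemma repetition_R_of_notMem (hV : V.Nonempty) (lam : ℝ) (ν : W → ℝ) {w : W}
    (hw : w ∉ Set.range ι) (a : A) : (repetition V ι hV lam ν).R w a = 0 :=
  dif_neg hw

/-- A world state outside the range of `ι` senses every element of V, which makes V ambiguous even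
when there is only one action. -/
lemma ambiguous_repetition [Nonempty A] (hι : Function.Injective ι)
    (hs : ¬ Function.Surjective ι) (hV : V.Nonempty) (lam : ℝ) (ν : W → ℝ) :
    (repetition V ι hV lam ν).ambiguous = V := by
  classical
  obtain ⟨e, he⟩ := not_forall.1 hs
  ext s
  constructor
  · intro h
    obtain ⟨w, hw⟩ := (Set.ncard_pos (Set.toFinite _)).1 (zero_lt_one.trans h)
    by_contra hsV
    refine hw ?_
    by_cases hx : w ∈ Set.range ι
    · obtain ⟨x, rfl⟩ := hx
      rw [repetition_β_apply hι]
      exact Pi.single_eq_of_ne (fun h => hsV (by rw [h]; exact x.1.2)) _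
    · rw [repetition_β_of_notMem hV lam ν hx]
      exact if_neg hsV
  · intro hsV
    refine (Set.one_lt_ncard (Set.toFinite _)).2
      ⟨ι (⟨s, hsV⟩, Classical.arbitrary A), ?_, e, ?_, fun h => he ⟨_, h⟩⟩
    · simp [repetition_β_apply hι]
    · change (repetition V ι hV lam ν).β e s ≠ 0
      rw [repetition_β_of_notMem hV lam ν he]
      beta_reduce
      rw [if_pos hsV]
      exact inv_ne_zero (Nat.cast_ne_zero.2 ((Set.ncard_pos (Set.toFinite V)).2 hV).ne')

lemma repetition_actionProb (hι : Function.Injective ι) (hV : V.Nonempty) (lam : ℝ) (ν : W → ℝ)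
    (π : S → A → ℝ) (x : V × A) (a : A) :
    (repetition V ι hV lam ν).actionProb π (ι x) a = π x.1 a := by
  classical
  simp [actionProb, repetition_β_apply hι, Pi.single_apply]

/-- Each block ι(s,·) keeps its mass and redistributes it by π(·|s); states outside the range are
fixed and send nothing in. -/
lemma repetition_vecMul_transition (hι : Function.Injective ι) (hV : V.Nonempty) (lam : ℝ)
    (ν : W → ℝ) (π : S → A → ℝ) (p : W → ℝ) (s : V) (a : A) :
    (p ᵥ* (repetition V ι hV lam ν).transition π) (ι (s, a)) = (∑ b, p (ι (s, b))) * π s a := by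
  classical
  simp only [vecMul, dotProduct]
  refine (Fintype.sum_of_injective ι hι (fun x : V × A =>
    if x.1 = s then p (ι x) * π s a else 0) _ ?_ ?_).symm.trans ?_
  · intro w hw
    refine mul_eq_zero_of_right _ (Finset.sum_eq_zero fun b _ => mul_eq_zero_of_right _ ?_)
    have hne : ι (s, a) ≠ recordAction V ι w b := by
      rw [recordAction, dif_neg (by exact hw)]
      exact fun h => hw ⟨_, h⟩
    exact Pi.single_eq_of_ne hne _
  · intro x
    have h : ∀ b, (repetition V ι hV lam ν).α (ι x) b (ι (s, a)) =
        if x.1 = s ∧ b = a then 1 else 0 := fun b => by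
      change Pi.single (recordAction V ι (ι x) b) 1 _ = _
      rw [recordAction_apply hι, Pi.single_apply, hι.eq_iff, Prod.mk.injEq]
      by_cases hb : x.1 = s ∧ b = a
      · rw [if_pos hb, if_pos ⟨hb.1.symm, hb.2.symm⟩]
      · rw [if_neg hb, if_neg fun h => hb ⟨h.1.symm, h.2.symm⟩]
    simp only [transition, Matrix.of_apply, h, repetition_actionProb hι]
    by_cases hx : x.1 = s <;> simp [hx]
  · rw [Fintype.sum_prod_type, Finset.sum_comm]
    simp [Finset.sum_mul]

lemma restart_restart_repetition (hV : V.Nonempty) (lam : ℝ) (ν : W → ℝ) {γ c lam' : ℝ}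
    (h0 : 0 < γ) (h1 : γ < 1) (k0 : 0 < c) (k1 : c < 1) {μ u ν' : W → ℝ}
    (hμ : μ ∈ stdSimplex ℝ W) (hu : u ∈ stdSimplex ℝ W) (m0 : 0 < lam') (m1 : lam' < 1)
    (hν' : ν' ∈ stdSimplex ℝ W) (e : lam' = γ * c)
    (e' : (1 - lam') • ν' = (γ * (1 - c)) • u + (1 - γ) • μ) :
    ((repetition V ι hV lam ν).restart k0 k1 hu).restart h0 h1 hμ =
      (repetition V ι hV lam ν).restart m0 m1 hν' := by
  simp only [restart, POMDP.mk.injEq, and_true]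
  funext w a
  rw [e', e, smul_add, smul_smul, smul_smul, add_assoc]

open Classical in
/-- The stationary reward of the repetition POMDP is, up to a negative factor at each sensor state,
the sum of the squared action probabilities. -/
lemma repetition_stationaryReward (hι : Function.Injective ι) (hV : V.Nonempty) {lam : ℝ}
    (h0 : 0 < lam) (h1 : lam < 1) {ν : W → ℝ} (hν : ν ∈ stdSimplex ℝ W)
    (hpos : ∀ s : V, 0 < ∑ b, ν (ι (s, b))) {π : S → A → ℝ} (hπ : π ∈ policyPolytope S A)
    {p : W → ℝ} (hp : ((repetition V ι hV lam ν).restart h0 h1 hν).IsStationary π p) :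
    p ⬝ᵥ (repetition V ι hV lam ν).stateReward π =
      -lam * ∑ s : V, (∑ b, ν (ι (s, b))) * ∑ a, π s a ^ 2 := by
  classical
  obtain ⟨hp, hpP⟩ := hp
  rw [transition_restart _ _ _ _ hπ, vecMul_restartMatrix _ _ _ hp] at hpP
  have hpa : ∀ (s : V) a, p (ι (s, a)) =
      lam * ((∑ b, p (ι (s, b))) * π s a) + (1 - lam) * ν (ι (s, a)) := fun s a => by
    have := congrFun hpP (ι (s, a))
    simp only [Pi.add_apply, Pi.smul_apply, repetition_vecMul_transition hι, smul_eq_mul] at this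
    exact this.symm
  -- Since blocks exchange mass only through restarts, the block masses are those of ν, whatever π
  -- is.
  have hps : ∀ s : V, ∑ b, p (ι (s, b)) = ∑ b, ν (ι (s, b)) := fun s => by
    have h2 : ∑ a, p (ι (s, a)) = _ := Finset.sum_congr rfl fun a _ => hpa s a
    rw [Finset.sum_add_distrib, ← Finset.mul_sum, ← Finset.mul_sum, ← Finset.mul_sum, (hπ s).2,
      mul_one] at h2
    have h3 : (1 - lam) * ∑ b, p (ι (s, b)) = (1 - lam) * ∑ b, ν (ι (s, b)) := by linarith
    exact mul_left_cancel₀ (sub_pos.2 h1).ne' h3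
  simp only [dotProduct]
  refine (Fintype.sum_of_injective ι hι (fun x : V × A => p (ι x) * (-π x.1 x.2 +
    ∑ a, π x.1 a * ((1 - lam) * ν (ι (x.1, a)) / ∑ b, ν (ι (x.1, b))))) _ ?_ ?_).symm.trans ?_
  · intro w hw
    refine mul_eq_zero_of_right _ (Finset.sum_eq_zero fun a _ => ?_)
    rw [repetition_R_of_notMem hV lam ν hw, mul_zero]
  · intro x
    simp only [stateReward, repetition_actionProb hι, repetition_R_apply hι, mul_add,
      Finset.sum_add_distrib]
    simp
  · rw [Fintype.sum_prod_type, Finset.mul_sum]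
    refine Finset.sum_congr rfl fun s _ => ?_
    have hd := (hpos s).ne'
    simp only [mul_add, Finset.sum_add_distrib, ← Finset.sum_mul, hps]
    rw [Finset.mul_sum Finset.univ (fun a => π s a ^ 2), Finset.mul_sum,
      Finset.mul_sum, ← Finset.sum_add_distrib]
    refine Finset.sum_congr rfl fun a _ => ?_
    -- The part (1-lam) ν of p contributes a penalty linear in π, which the compensating reward
    -- cancels exactly; only the squares remain.
    rw [hpa, hps]
    field_simp
    ring

variable [DecidableEq W]

open Classical in
/-- A policy of maximal stationary reward in the repetition POMDP uses all actions at the sensor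
states in `V`. -/
lemma repetition_pos [Nonempty A] (hι : Function.Injective ι) (hV : V.Nonempty) {lam : ℝ}
    (h0 : 0 < lam) (h1 : lam < 1) {ν : W → ℝ} (hν : ν ∈ stdSimplex ℝ W)
    (hpos : ∀ s : V, 0 < ∑ b, ν (ι (s, b))) {π : S → A → ℝ} (hπ : π ∈ policyPolytope S A)
    {p : W → ℝ} (hp : ((repetition V ι hV lam ν).restart h0 h1 hν).IsStationary π p)
    (hmax : ∀ π' ∈ policyPolytope S A, ∀ p',
      ((repetition V ι hV lam ν).restart h0 h1 hν).IsStationary π' p' →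
        p' ⬝ᵥ (repetition V ι hV lam ν).stateReward π' ≤
          p ⬝ᵥ (repetition V ι hV lam ν).stateReward π) {s : S} (hs : s ∈ V) (a : A) :
    0 < π s a := by
  by_contra hsa
  have h2 : π s a = 0 := le_antisymm (not_lt.1 hsa) ((hπ s).1 a)
  have hπ' : (fun _ _ => (Fintype.card A : ℝ)⁻¹) ∈ policyPolytope S A :=
    fun _ => inv_card_mem_stdSimplex A
  obtain ⟨p', hp', -⟩ := uniqueStationary_restart _ h0 h1 hν _ hπ'
  have h3 := hmax _ hπ' p' hp'
  rw [repetition_stationaryReward hι hV h0 h1 hν hpos hπ hp,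
    repetition_stationaryReward hι hV h0 h1 hν hpos hπ' hp'] at h3
  have h4 := le_of_mul_le_mul_left (by linarith) h0
    (b := ∑ s : V, (∑ b, ν (ι (s, b))) * ∑ a, π s a ^ 2)
    (c := ∑ s : V, (∑ b, ν (ι (s, b))) * ∑ a : A, (Fintype.card A : ℝ)⁻¹ ^ 2)
  refine h4.not_gt (Finset.sum_lt_sum (fun s _ => ?_) ⟨⟨s, hs⟩, Finset.mem_univ _, ?_⟩)
  · refine mul_le_mul_of_nonneg_left ?_ (hpos s).le
    rw [sum_sq_eq_of_mem_stdSimplex (hπ s),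
      sum_sq_eq_of_mem_stdSimplex (inv_card_mem_stdSimplex A)]
    simpa using Finset.sum_nonneg fun a _ => sq_nonneg (π s a - (Fintype.card A : ℝ)⁻¹)
  · refine mul_lt_mul_of_pos_left ?_ (hpos _)
    rw [sum_sq_eq_of_mem_stdSimplex (hπ s),
      sum_sq_eq_of_mem_stdSimplex (inv_card_mem_stdSimplex A)]
    have : 0 < ∑ a, (π s a - (Fintype.card A : ℝ)⁻¹) ^ 2 :=
      -- An unused action deviates from the uniform weight, so the sum of squares is strictly above
      -- its minimum.
      Finset.sum_pos' (fun a _ => sq_nonneg _) ⟨a, Finset.mem_univ a, by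
        rw [h2, zero_sub, neg_sq]
        exact pow_pos (inv_pos.2 (Nat.cast_pos.2 Fintype.card_pos)) 2⟩
    simpa using this

end POMDP

lemma exists_injective_not_surjective {W S A : Type*} [Fintype W] [Fintype S] [Fintype A]
    {V : Set S} (h : V.ncard * Fintype.card A < Fintype.card W) :
    ∃ ι : V × A → W, Function.Injective ι ∧ ¬ Function.Surjective ι := by
  classical
  have hc : Fintype.card (V × A) = V.ncard * Fintype.card A := by
    rw [Fintype.card_prod, Set.ncard_eq_toFinset_card', Set.toFinset_card]
  obtain ⟨ι⟩ := Function.Embedding.nonempty_of_card_le (α := V × A) (β := W) (by omega)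
  exact ⟨ι, ι.injective, fun hs => by have := Fintype.card_le_of_surjective _ hs; omega⟩

theorem mainTheorem1 {W S A : Type*} [Fintype W] [Fintype S] [Fintype A] [DecidableEq W]
    [Nonempty W] [Nonempty A] :
    -- existence for the average reward
    (∀ M : POMDP W S A, M.UniqueStationary →
      ∃ π, M.IsOptimalAverage π ∧
        IsStochastic (M.ambiguous.ncard * (Fintype.card A - 1)) π) ∧
    -- existence for the discounted reward
    (∀ (M : POMDP W S A) (γ : ℝ), 0 < γ → γ < 1 → ∀ μ ∈ stdSimplex ℝ W,
      ∃ π, M.IsOptimalDiscounted γ μ π ∧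
        IsStochastic (M.ambiguous.ncard * (Fintype.card A - 1)) π) ∧
    -- sharpness for the average reward
    (∀ V : Set S, V.Nonempty → V.ncard * Fintype.card A < Fintype.card W →
      ∃ M : POMDP W S A, M.UniqueStationary ∧ M.AttainsStationary ∧ M.ambiguous = V ∧
        ∀ π, M.IsOptimalAverage π →
          ∀ k, IsStochastic k π → V.ncard * (Fintype.card A - 1) ≤ k) ∧
    -- sharpness for the discounted reward
    (∀ V : Set S, V.Nonempty → V.ncard * Fintype.card A < Fintype.card W →
      ∀ γ : ℝ, 0 < γ → γ < 1 → ∀ μ ∈ stdSimplex ℝ W,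
        ∃ M : POMDP W S A, M.UniqueStationary ∧ M.AttainsStationary ∧ M.ambiguous = V ∧
          ∀ π, M.IsOptimalDiscounted γ μ π →
            ∀ k, IsStochastic k π → V.ncard * (Fintype.card A - 1) ≤ k) := by
  have hu := inv_card_mem_stdSimplex W
  have hu0 : (0 : ℝ) < (Fintype.card W : ℝ)⁻¹ := inv_pos.2 (Nat.cast_pos.2 Fintype.card_pos)
  have hc0 : (0 : ℝ) < 1 / 2 := by norm_num
  have hc1 : (1 / 2 : ℝ) < 1 := by norm_num
  refine ⟨fun M hM => M.exists_isOptimalAverage hM,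
    fun M γ h0 h1 μ hμ => M.exists_isOptimalDiscounted h0 h1 hμ, fun V hV hcard => ?_,
    fun V hV hcard γ h0 h1 μ hμ => ?_⟩
  · obtain ⟨ι, hι, hs⟩ := exists_injective_not_surjective hcard
    -- Any restart probability in (0,1) would do; the uniform restart gives every block positive
    -- mass.
    set M₀ := POMDP.repetition V ι hV (1 / 2) fun _ => (Fintype.card W : ℝ)⁻¹
    have hM := M₀.uniqueStationary_restart hc0 hc1 hu
    refine ⟨M₀.restart hc0 hc1 hu, hM, M₀.attainsStationary_restart hc0 hc1 hu,
      POMDP.ambiguous_repetition hι hs hV (1 / 2) fun _ => (Fintype.card W : ℝ)⁻¹, fun π ho k hk => ?_⟩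
    obtain ⟨p, hp, -⟩ := hM π ho.1
    exact le_of_isStochastic (fun s hs a => POMDP.repetition_pos hι hV hc0 hc1 hu
      (fun s => Finset.sum_pos (fun _ _ => hu0) Finset.univ_nonempty) ho.1 hp
      (fun π' hπ' p' hp' => ho.stationary_le hM hp hπ' hp') hs a) hk
  · obtain ⟨ι, hι, hs⟩ := exists_injective_not_surjective hcard
    have m0 : 0 < γ * (1 / 2) := by positivity
    have m1 : γ * (1 / 2) < 1 := by linarith
    have m1' : 0 < 1 - γ * (1 / 2) := sub_pos.2 m1
    set u : W → ℝ := fun _ => (Fintype.card W : ℝ)⁻¹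
    -- Discounting adds a second restart, in μ. The two combine into one with continuation
    -- probability γ/2 and this mixture ν; its uniform part keeps ν positive where μ vanishes. The
    -- rewards of `M₀` compensate for this combined restart.
    set ν : W → ℝ := (γ * (1 - 1 / 2) / (1 - γ * (1 / 2))) • u + ((1 - γ) / (1 - γ * (1 / 2))) • μ
    have hν : ν ∈ stdSimplex ℝ W := by
      refine convex_stdSimplex ℝ W hu hμ (div_nonneg (by linarith) m1'.le)
        (div_nonneg (by linarith) m1'.le) ?_
      rw [← add_div, div_eq_one_iff_eq m1'.ne']
      ring
    have hνpos : ∀ w, 0 < ν w := fun w =>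
      add_pos_of_pos_of_nonneg (mul_pos (div_pos (by linarith) m1') hu0)
        (mul_nonneg (div_nonneg (by linarith) m1'.le) (hμ.1 w))
    set M₀ := POMDP.repetition V ι hV (γ * (1 / 2)) ν
    have hM := M₀.uniqueStationary_restart hc0 hc1 hu
    have hr : (M₀.restart hc0 hc1 hu).restart h0 h1 hμ = M₀.restart m0 m1 hν :=
      POMDP.restart_restart_repetition hV _ _ h0 h1 hc0 hc1 hμ hu m0 m1 hν rfl (by
        simp only [ν, smul_add, smul_smul]
        rw [mul_div_cancel₀ _ m1'.ne', mul_div_cancel₀ _ m1'.ne'])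
    refine ⟨M₀.restart hc0 hc1 hu, hM, M₀.attainsStationary_restart hc0 hc1 hu,
      POMDP.ambiguous_repetition hι hs hV (γ * (1 / 2)) ν, fun π ho k hk => ?_⟩
    obtain ⟨p, hp, -⟩ := M₀.uniqueStationary_restart m0 m1 hν π ho.1
    refine le_of_isStochastic (fun s hs a => POMDP.repetition_pos hι hV m0 m1 hν
      (fun s => Finset.sum_pos (fun _ _ => hνpos _) Finset.univ_nonempty) ho.1 hp
      (fun π' hπ' p' hp' => ?_) hs a) hk
    exact ho.stationary_le h0 h1 hμ (hr ▸ hp) hπ' (hr ▸ hp')
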